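/- Let $K$ be an algebraically closed field. For a finite-dimensional graded vector space $V=\bigoplus_{i\in\mathbb Z}V_i$ over $K$, consider the affine variety of graded associative algebra structures on $V$, i.e. of associative bilinear maps $\mu:V\times V\to V$ with $\mu(V_i,V_j)\subseteq V_{i+j}$, with the action $(g\cdot\mu)(x,y)=g\,\mu(g^{-1}x,g^{-1}y)$ of the group of linear automorphisms $g$ of $V$ of degree $0$. Let $A$ and $B$ be finite-dimensional $\mathbb Z$-graded unital associative $K$-algebras. We say that $B$ is a graded degeneration of $A$ if $A$ and $B$ have the same underlying graded vector space $V$ up to isomorphism and, regarding both as points of this variety, the orbit of $B$ is contained in the Zariski closure of the orbit of $A$. Let $N\ge 2$ and put $n(2i)=iN$ and $n(2i+1)=iN+1$ for $i\ge 0$. A finite-dimensional graded unital $K$-algebra $A\neq 0$ is called $N$-Koszul if it is generated as a unital $K$-algebra by $A_1$ (so that $A_0=K$ and $J=\bigoplus_{i\ge1}A_i$ is an ideal with $A/J=K$) and $\operatorname{Tor}^A_{ij}(K,K)=0$ for all integers $i,j\ge 0$ with $j\ne n(i)$, where $\operatorname{Tor}^A_{ij}(K,K)$ denotes the homogeneous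 component of internal degree $j$ of $\operatorname{Tor}^A_i(K,K)$. Proposition. If $B$ is a graded degeneration of $A$ and $B$ is $N$-Koszul, then $A$ is $N$-Koszul. -/

import Mathlib

/-! ### Graded degenerations -/

section Degeneration

variable {K : Type*} [Field K] {V W : Type*} [AddCommGroup V] [Module K V]
  [AddCommGroup W] [Module K W]

/-- Transport of a bilinear multiplication `μ` on `V` along a linear isomorphism `e : V ≃ W`:
`(e · μ)(x, y) = e (μ (e⁻¹ x, e⁻¹ y))`. For `W = V` this is the action of `GL(V)`. -/
def transportMul (e : V ≃ₗ[K] W) (μ : V →ₗ[K] V →ₗ[K] V) : W →ₗ[K] W →ₗ[K] W :=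
  (μ.compl₁₂ (e.symm : W →ₗ[K] V) (e.symm : W →ₗ[K] V)).compr₂ (e : V →ₗ[K] W)

/-- The set of graded associative algebra structures on the graded vector space
`V = ⨁ i, 𝒱 i`. -/
def gradedAss (𝒱 : ℤ → Submodule K V) : Set (V →ₗ[K] V →ₗ[K] V) :=
  {μ | (∀ x y z : V, μ (μ x y) z = μ x (μ y z)) ∧
    ∀ (i j : ℤ) (x y : V), x ∈ 𝒱 i → y ∈ 𝒱 j → μ x y ∈ 𝒱 (i + j)}

/-- The orbit of `μ` under the group of linear automorphisms of `V` of degree zero. -/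
def gradedOrbit (𝒱 : ℤ → Submodule K V) (μ : V →ₗ[K] V →ₗ[K] V) :
    Set (V →ₗ[K] V →ₗ[K] V) :=
  {ν | ∃ g : V ≃ₗ[K] V, (∀ i, (𝒱 i).map (g : V →ₗ[K] V) = 𝒱 i) ∧ ν = transportMul g μ}

/-- The Zariski closure of a subset `S` of a finite-dimensional vector space `W`: the points
at which every polynomial function vanishing on `S` vanishes. Polynomial functions on `W` are
the polynomial expressions in the linear forms on `W`. -/
def zariskiClosure (S : Set W) : Set W :=
  {x | ∀ p : MvPolynomial (Module.Dual K W) K,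
    (∀ y ∈ S, MvPolynomial.eval (fun l : Module.Dual K W => l y) p = 0) →
      MvPolynomial.eval (fun l : Module.Dual K W => l x) p = 0}

/-- `IsGradedDegeneration 𝒜 ℬ`: the graded algebra `B` is a graded degeneration of the graded
algebra `A`. Both are regarded as points of the variety of graded algebra structures on one
graded vector space (the one underlying `B`) by means of a graded linear isomorphism `e`,
and the orbit of `B` is contained in the Zariski closure of the orbit of `A` in that variety.
(Whether this holds does not depend on `e`.) -/
def IsGradedDegeneration {A B : Type*} [Ring A] [Algebra K A] [Ring B] [Algebra K B]
    (𝒜 : ℤ → Submodule K A) (ℬ : ℤ → Submodule K B) : Prop :=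
  ∃ e : A ≃ₗ[K] B, (∀ i, (𝒜 i).map (e : A →ₗ[K] B) = ℬ i) ∧
    gradedOrbit ℬ (LinearMap.mul K B) ⊆
      gradedAss ℬ ∩ zariskiClosure (K := K)
        (gradedOrbit ℬ (transportMul e (LinearMap.mul K A)))

end Degeneration

/-! ### Graded `Tor` and `N`-Koszul algebras -/

universe u v

section Koszul

variable {K : Type u} [Field K] {A : Type v} [Ring A] [Algebra K A]

/-- The left ideal `J` generated by the homogeneous elements of positive degree. If `A` is
generated by `𝒜 1` it is the two-sided ideal `⨁ i ≥ 1, 𝒜 i`, and `A ⧸ J` is the `A`-module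
`K`. -/
def augIdeal (𝒜 : ℤ → Submodule K A) : Ideal A :=
  Ideal.span {a | ∃ i : ℤ, 1 ≤ i ∧ a ∈ 𝒜 i}

/-- A resolution of the left `A`-module `K = A ⧸ J`, placed in degree zero, by graded projective
left `A`-modules `X i = ⨁ j, deg i j`, with differentials and augmentation of degree zero. -/
structure GradedProjectiveResolution (𝒜 : ℤ → Submodule K A) where
  X : ℕ → Type v
  [addCommGroup : ∀ i, AddCommGroup (X i)]
  [module : ∀ i, Module A (X i)]
  deg : ∀ i, ℤ → AddSubgroup (X i)
  isInternal : ∀ i, DirectSum.IsInternal (deg i)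
  smul_mem : ∀ (i : ℕ) (m n : ℤ) (a : A) (x : X i),
    a ∈ 𝒜 m → x ∈ deg i n → a • x ∈ deg i (m + n)
  projective : ∀ i, Module.Projective A (X i)
  d : ∀ i, X (i + 1) →ₗ[A] X i
  d_mem : ∀ (i : ℕ) (j : ℤ) (x : X (i + 1)), x ∈ deg (i + 1) j → d i x ∈ deg i j
  aug : X 0 →ₗ[A] A ⧸ augIdeal 𝒜
  aug_eq_zero : ∀ (j : ℤ) (x : X 0), j ≠ 0 → x ∈ deg 0 j → aug x = 0
  aug_surjective : Function.Surjective aug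
  exact_aug : Function.Exact (d 0) aug
  exact_d : ∀ i, Function.Exact (d (i + 1)) (d i)

namespace GradedProjectiveResolution

attribute [instance] addCommGroup module

variable {𝒜 : ℤ → Submodule K A} (P : GradedProjectiveResolution 𝒜)

/-- The term `K ⊗_A X i` of the complex `K ⊗_A P`, for the right `A`-module `K = A ⧸ J`;
it is the quotient of `X i` by `J X i`. -/
abbrev Red (i : ℕ) : Type v := P.X i ⧸ (augIdeal 𝒜 • (⊤ : Submodule A (P.X i)))

/-- The differential of `K ⊗_A P`. -/
def redD (i : ℕ) : P.Red (i + 1) →ₗ[A] P.Red i :=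
  Submodule.mapQ _ _ (P.d i) (Submodule.smul_top_le_comap_smul_top _ _)

/-- The homogeneous component of degree `j` of `K ⊗_A X i`. -/
def redDeg (i : ℕ) (j : ℤ) : AddSubgroup (P.Red i) :=
  (P.deg i j).map (Submodule.mkQ (augIdeal 𝒜 • (⊤ : Submodule A (P.X i)))).toAddMonoidHom

/-- The cycles of `K ⊗_A P`. -/
def cycles : (i : ℕ) → AddSubgroup (P.Red i)
  | 0 => ⊤
  | i + 1 => (P.redD i).toAddMonoidHom.ker

/-- The homogeneous cycles of homological degree `i` and internal degree `j`. -/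
def cyclesDeg (i : ℕ) (j : ℤ) : AddSubgroup (P.Red i) := P.redDeg i j ⊓ P.cycles i

/-- The homogeneous boundaries of homological degree `i` and internal degree `j`. -/
def boundariesDeg (i : ℕ) (j : ℤ) : AddSubgroup (P.Red i) :=
  (P.redDeg (i + 1) j).map (P.redD i).toAddMonoidHom

/-- `Tor^A_{ij}(K, K)` computed with the resolution `P`: the component of internal degree `j`
of the homology of `K ⊗_A P` in homological degree `i`. -/
abbrev Tor (i : ℕ) (j : ℤ) : Type v :=
  P.cyclesDeg i j ⧸ (P.boundariesDeg i j).addSubgroupOf (P.cyclesDeg i j)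

end GradedProjectiveResolution

/-- `Tor^A_{ij}(K, K) = 0`. As `Tor` does not depend on the projective resolution,
it is enough to see this on one of them. -/
def TorVanishes (𝒜 : ℤ → Submodule K A) (i : ℕ) (j : ℤ) : Prop :=
  ∃ P : GradedProjectiveResolution 𝒜, Subsingleton (P.Tor i j)

/-- `n(2i) = iN` and `n(2i+1) = iN + 1`. -/
def koszulDegree (N i : ℕ) : ℕ := (i / 2) * N + i % 2

/-- The graded algebra `A = ⨁ i, 𝒜 i` is `N`-Koszul: it is nonzero and generated as a unital
`K`-algebra by `𝒜 1` (so that `𝒜 0 = K` and `𝒜 i = 0` for `i < 0`), and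
`Tor^A_{ij}(K, K) = 0` for all `i, j ≥ 0` with `j ≠ n(i)`. -/
structure IsNKoszul (N : ℕ) (𝒜 : ℤ → Submodule K A) : Prop where
  nontrivial : Nontrivial A
  generated : Algebra.adjoin K (𝒜 1 : Set A) = ⊤
  tor : ∀ i j : ℕ, j ≠ koszulDegree N i → TorVanishes 𝒜 i j

end Koszul

/-!
`N`-Koszulity of a connected graded algebra is the vanishing of homology groups of its reduced bar
complex in certain bidegrees, and vanishing of homology is an open condition on the structure
constants of the algebra. If `B` lies in the closure of the orbit of `A`, then every open set
containing `B` meets the orbit of `A`, so each vanishing passes from `B` to `A`.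

In detail: since `B` is generated in degree one it is connected and has a homogeneous basis
`1, b_a` with all `b_a` of positive degree (`AugBasis.exists_of_adjoin_eq_top`). Each point of the
orbit of `A`, being a graded structure on the space of `B`, pulls this basis back to one of `A`
(`AugBasis.comapEquiv`), whose structure constants are the values of fixed linear forms at that
point. The reduced bar complex is spanned by words in the letters `a`, with differential `barD`
polynomial in the structure constants. It is the reduction modulo the augmentation ideal of the
bar resolution, a graded projective resolution (`AugBasis.barResolution`), so that exactness of it
in bidegree `(n + 1, j)` is the vanishing of `Tor` computed with that resolution
(`AugBasis.subsingleton_tor_barResolution_iff`). The hypothesis on `B` concerns arbitrary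
resolutions, and a comparison of graded projective resolutions transfers it to the bar resolution
(`GradedProjectiveResolution.subsingleton_tor_of_subsingleton_tor`).

Openness is `exists_polynomial_exact`: a contraction `S`, `T` of the complex at the point `B` gives
the polynomial `det (S D₁ + D₀ T)`, which is `1` at `B`, and the complex is exact at each point
where it does not vanish. Finally, `A` is generated by `A₁` because exactness in the bidegrees
`(1, j)`, `j ≠ 1`, makes all elements of degree `j` decomposable (`AugBasis.adjoin_eq_top`).
-/

/-! ### Homogeneous components and graded lifting -/

section HomogeneousComponent

variable {X : Type*} [AddCommGroup X] {deg : ℤ → AddSubgroup X}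

/-- The projection of an internally graded abelian group onto its component of degree `j`,
as an endomorphism. -/
noncomputable def homogeneousComponent (h : DirectSum.IsInternal deg) (j : ℤ) : X →+ X :=
  letI := h.chooseDecomposition
  (deg j).subtype.comp ((DFinsupp.evalAddMonoidHom j).comp
    (DirectSum.decomposeAddEquiv deg).toAddMonoidHom)

theorem homogeneousComponent_mem (h : DirectSum.IsInternal deg) (j : ℤ) (x : X) :
    homogeneousComponent h j x ∈ deg j := by
  simp [homogeneousComponent]

theorem homogeneousComponent_of_mem (h : DirectSum.IsInternal deg) {i : ℤ} {x : X}
    (hx : x ∈ deg i) (j : ℤ) : homogeneousComponent h j x = if i = j then x else 0 := by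
  let := h.chooseDecomposition
  split_ifs with hij
  · subst hij
    exact DirectSum.decompose_of_mem_same deg hx
  · exact DirectSum.decompose_of_mem_ne deg hx hij

theorem homogeneous_induction (h : DirectSum.IsInternal deg) {p : X → Prop} (zero : p 0)
    (mem : ∀ j, ∀ x ∈ deg j, p x) (add : ∀ x y, p x → p y → p (x + y)) (x : X) : p x := by
  let := h.chooseDecomposition
  exact DirectSum.Decomposition.inductionOn deg zero (fun m => mem _ _ m.2) add x

/-- A family of projections with the formal properties of homogeneous components shows that a
family of subgroups is an internal grading. -/
theorem isInternal_of_projections (π : ℤ → X →+ X)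
    (hπ : ∀ i x, x ∈ deg i → ∀ j, π j x = if i = j then x else 0)
    (htop : ∀ x, x ∈ ⨆ j, deg j) : DirectSum.IsInternal deg := by
  classical
  constructor
  · rw [injective_iff_map_eq_zero]
    intro x hx
    have key : ∀ (y : DirectSum ℤ fun i => deg i) (j : ℤ),
        π j (DirectSum.coeAddMonoidHom deg y) = y j := by
      intro y j
      induction y using DirectSum.induction_on with
      | zero => simp
      | of i y =>
        rw [DirectSum.coeAddMonoidHom_of, hπ i _ y.2]
        split_ifs with hij
        · subst hij; simp
        · simp [DirectSum.of_eq_of_ne _ _ _ (Ne.symm hij)]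
      | add y z hy hz => simp [hy, hz]
    ext j
    rw [← key x j, hx]
    simp
  · intro x
    have hle : ⨆ j, deg j ≤ (DirectSum.coeAddMonoidHom deg).range :=
      iSup_le fun j y hy => ⟨DirectSum.of _ j ⟨y, hy⟩, by simp⟩
    exact hle (htop x)

end HomogeneousComponent

section GradedLift

variable {K : Type*} [Field K] {A : Type*} [Ring A] [Algebra K A]
  {X : Type*} [AddCommGroup X] [Module A X] {degX : ℤ → AddSubgroup X}
  {Y : Type*} [AddCommGroup Y] [Module A Y] {degY : ℤ → AddSubgroup Y}
  {Z : Type*} [AddCommGroup Z] [Module A Z]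

/-- Taking homogeneous components commutes with homogeneous scalars, up to the shift. -/
theorem homogeneousComponent_smul {𝒜 : ℤ → Submodule K A} (hY : DirectSum.IsInternal degY)
    (hYs : ∀ (m n : ℤ) (a : A) (y : Y), a ∈ 𝒜 m → y ∈ degY n → a • y ∈ degY (m + n))
    {m : ℤ} {a : A} (ha : a ∈ 𝒜 m) (n : ℤ) (y : Y) :
    homogeneousComponent hY (m + n) (a • y) = a • homogeneousComponent hY n y := by
  induction y using homogeneous_induction hY with
  | zero => simp
  | mem j y hy =>
    rw [homogeneousComponent_of_mem hY (hYs _ _ _ _ ha hy), homogeneousComponent_of_mem hY hy]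
    simp
  | add y z hy hz => simp [smul_add, hy, hz]

/-- Projectivity of the underlying ungraded module suffices to lift a graded map `φ` along a
graded map `ψ`: the degree-zero part of an ungraded lift is a graded lift. The compatibility of
`φ` and `ψ` with the gradings enters through `hcomp`, so that `Z` needs no grading. -/
theorem exists_graded_lift (𝒜 : ℤ → Submodule K A) [GradedAlgebra 𝒜] [Module.Projective A X]
    (hX : DirectSum.IsInternal degX)
    (hXs : ∀ (m n : ℤ) (a : A) (x : X), a ∈ 𝒜 m → x ∈ degX n → a • x ∈ degX (m + n))
    (hY : DirectSum.IsInternal degY)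
    (hYs : ∀ (m n : ℤ) (a : A) (y : Y), a ∈ 𝒜 m → y ∈ degY n → a • y ∈ degY (m + n))
    (ψ : Y →ₗ[A] Z) (φ : X →ₗ[A] Z) (hφ : ∀ x, φ x ∈ LinearMap.range ψ)
    (hcomp : ∀ j x y, x ∈ degX j → ψ y = φ x → ψ (homogeneousComponent hY j y) = φ x) :
    ∃ θ : X →ₗ[A] Y, (∀ j x, x ∈ degX j → θ x ∈ degY j) ∧ ∀ x, ψ (θ x) = φ x := by
  obtain ⟨θ', hθ'⟩ := Module.projective_lifting_property ψ.rangeRestrict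
    (φ.codRestrict (LinearMap.range ψ) hφ) (LinearMap.surjective_rangeRestrict ψ)
  have hθ'' : ∀ x, ψ (θ' x) = φ x := fun x => congrArg Subtype.val (LinearMap.congr_fun hθ' x)
  let := hX.chooseDecomposition
  let θ₀ : X →+ Y := (DirectSum.toAddMonoid fun j =>
    (homogeneousComponent hY j).comp (θ'.toAddMonoidHom.comp (degX j).subtype)).comp
      (DirectSum.decomposeAddEquiv degX).toAddMonoidHom
  have hθ₀ : ∀ j x, x ∈ degX j → θ₀ x = homogeneousComponent hY j (θ' x) := by
    intro j x hx
    simp [θ₀, DirectSum.decompose_of_mem degX hx]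
  have hsmul : ∀ (a : A) (x : X), θ₀ (a • x) = a • θ₀ x := by
    intro a x
    induction a using DirectSum.Decomposition.inductionOn 𝒜 with
    | zero => simp
    | add a b ha hb => simp [add_smul, ha, hb]
    | @homogeneous m a =>
      induction x using homogeneous_induction hX with
      | zero => simp
      | add x y hx hy => simp [smul_add, hx, hy]
      | mem n x hx =>
        rw [hθ₀ _ _ (hXs m n a x a.2 hx), hθ₀ _ _ hx, map_smul,
          homogeneousComponent_smul hY hYs a.2]
  refine ⟨{ θ₀ with map_smul' := hsmul }, fun j x hx => ?_, fun x => ?_⟩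
  · change θ₀ x ∈ _
    rw [hθ₀ j x hx]
    exact homogeneousComponent_mem hY j _
  · change ψ (θ₀ x) = φ x
    induction x using homogeneous_induction hX with
    | zero => simp
    | add x y hx hy => simp [hx, hy]
    | mem j x hx =>
      rw [hθ₀ j x hx]
      exact hcomp j x _ hx (hθ'' x)

end GradedLift

/-! ### Independence of graded `Tor` of the resolution -/

namespace GradedProjectiveResolution

variable {K : Type u} [Field K] {A : Type v} [Ring A] [Algebra K A] {𝒜 : ℤ → Submodule K A}

section

variable (P : GradedProjectiveResolution 𝒜)

theorem d_d (i : ℕ) (x : P.X (i + 1 + 1)) : P.d i (P.d (i + 1) x) = 0 :=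
  (P.exact_d i _).2 ⟨x, rfl⟩

theorem aug_d (x : P.X 1) : P.aug (P.d 0 x) = 0 :=
  (P.exact_aug _).2 ⟨x, rfl⟩

theorem d_homogeneousComponent (i : ℕ) (j : ℤ) (x : P.X (i + 1)) :
    P.d i (homogeneousComponent (P.isInternal (i + 1)) j x) =
      homogeneousComponent (P.isInternal i) j (P.d i x) := by
  induction x using homogeneous_induction (P.isInternal (i + 1)) with
  | zero => simp
  | add x y hx hy => simp [hx, hy]
  | mem n x hx =>
    rw [homogeneousComponent_of_mem _ hx, homogeneousComponent_of_mem _ (P.d_mem _ _ _ hx)]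
    split_ifs <;> simp

theorem aug_homogeneousComponent (j : ℤ) (x : P.X 0) :
    P.aug (homogeneousComponent (P.isInternal 0) j x) = if j = 0 then P.aug x else 0 := by
  induction x using homogeneous_induction (P.isInternal 0) with
  | zero => simp
  | add x y hx hy => simp only [map_add, hx, hy]; split_ifs <;> simp
  | mem n x hx =>
    rw [homogeneousComponent_of_mem _ hx]
    by_cases hn : n = 0
    · subst hn
      simp only [eq_comm (a := (0 : ℤ))]
      split_ifs <;> simp
    · rw [P.aug_eq_zero n x hn hx]
      split_ifs <;> simp [P.aug_eq_zero n x hn hx]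

theorem mk_mem_cycles_succ (i : ℕ) (x : P.X (i + 1)) :
    (Submodule.Quotient.mk x : P.Red (i + 1)) ∈ P.cycles (i + 1) ↔
      P.d i x ∈ augIdeal 𝒜 • (⊤ : Submodule A (P.X i)) := by
  rw [← Submodule.Quotient.mk_eq_zero]
  rfl

/-- The vanishing of `Tor` in terms of representatives in the resolution. -/
theorem subsingleton_tor_iff (i : ℕ) (j : ℤ) :
    Subsingleton (P.Tor i j) ↔ ∀ x ∈ P.deg i j,
      (Submodule.Quotient.mk x : P.Red i) ∈ P.cycles i → ∃ y ∈ P.deg (i + 1) j,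
        x - P.d i y ∈ augIdeal 𝒜 • (⊤ : Submodule A (P.X i)) := by
  rw [QuotientAddGroup.subsingleton_iff, AddSubgroup.addSubgroupOf_eq_top]
  constructor
  · intro h x hx hc
    obtain ⟨_, ⟨y, hy, rfl⟩, hyx⟩ := h ⟨⟨x, hx, rfl⟩, hc⟩
    exact ⟨y, hy, (Submodule.Quotient.eq _).1 hyx.symm⟩
  · rintro h _ ⟨⟨x, hx, rfl⟩, hc⟩
    obtain ⟨y, hy, hyx⟩ := h x hx hc
    exact ⟨_, ⟨y, hy, rfl⟩, ((Submodule.Quotient.eq _).2 hyx).symm⟩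

end

variable [GradedAlgebra 𝒜]

/-- Two graded projective resolutions are related by a graded chain map over the identity. -/
theorem exists_chainMap (Q P : GradedProjectiveResolution 𝒜) :
    ∃ f : ∀ i, Q.X i →ₗ[A] P.X i, (∀ i j x, x ∈ Q.deg i j → f i x ∈ P.deg i j) ∧
      (∀ x, P.aug (f 0 x) = Q.aug x) ∧ ∀ i x, P.d i (f (i + 1) x) = f i (Q.d i x) := by
  have := Q.projective
  -- the second condition on the `i`-th map is what the construction of the next one needs
  let T : ℕ → Type v := fun i => {f : Q.X i →ₗ[A] P.X i //
    (∀ j x, x ∈ Q.deg i j → f x ∈ P.deg i j) ∧ ∀ x, f (Q.d i x) ∈ LinearMap.range (P.d i)}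
  have h0 : ∃ t : T 0, ∀ x, P.aug (t.1 x) = Q.aug x := by
    obtain ⟨f, hf, hfa⟩ := exists_graded_lift 𝒜 (Q.isInternal 0) (Q.smul_mem 0)
      (P.isInternal 0) (P.smul_mem 0) P.aug Q.aug (fun x => P.aug_surjective _) (by
        intro j x y hx hxy
        rw [aug_homogeneousComponent]
        split_ifs with hj
        · exact hxy
        · exact (Q.aug_eq_zero j x hj hx).symm)
    exact ⟨⟨f, hf, fun x => (P.exact_aug _).1 (by rw [hfa, aug_d])⟩, hfa⟩
  have hs : ∀ i (t : T i), ∃ t' : T (i + 1), ∀ x, P.d i (t'.1 x) = t.1 (Q.d i x) := by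
    intro i t
    obtain ⟨f, hf, hfd⟩ := exists_graded_lift 𝒜 (Q.isInternal (i + 1)) (Q.smul_mem (i + 1))
      (P.isInternal (i + 1)) (P.smul_mem (i + 1)) (P.d i) (t.1.comp (Q.d i)) t.2.2 (by
        intro j x y hx hxy
        rw [d_homogeneousComponent, hxy, LinearMap.comp_apply,
          homogeneousComponent_of_mem _ (t.2.1 j _ (Q.d_mem _ _ _ hx)), if_pos rfl])
    exact ⟨⟨f, hf, fun x => (P.exact_d i _).1 (by simp [hfd, d_d])⟩, hfd⟩
  choose t0 ht0 using h0
  choose next hnext using hs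
  let F : ∀ i, T i := fun i => Nat.rec t0 next i
  exact ⟨fun i => (F i).1, fun i => (F i).2.1, ht0, fun i => hnext i (F i)⟩

/-- A graded chain endomorphism over zero is null-homotopic by a graded homotopy. -/
theorem exists_homotopy (Q : GradedProjectiveResolution 𝒜) (h : ∀ i, Q.X i →ₗ[A] Q.X i)
    (hdeg : ∀ i j x, x ∈ Q.deg i j → h i x ∈ Q.deg i j) (haug : ∀ x, Q.aug (h 0 x) = 0)
    (hd : ∀ i x, Q.d i (h (i + 1) x) = h i (Q.d i x)) :
    ∃ s : ∀ i, Q.X i →ₗ[A] Q.X (i + 1), (∀ i j x, x ∈ Q.deg i j → s i x ∈ Q.deg (i + 1) j) ∧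
      (∀ x, h 0 x = Q.d 0 (s 0 x)) ∧
      ∀ i x, h (i + 1) x = Q.d (i + 1) (s (i + 1) x) + s i (Q.d i x) := by
  have := Q.projective
  let T : ℕ → Type v := fun i => {s : Q.X i →ₗ[A] Q.X (i + 1) //
    (∀ j x, x ∈ Q.deg i j → s x ∈ Q.deg (i + 1) j) ∧
      ∀ x, h (i + 1) x - s (Q.d i x) ∈ LinearMap.range (Q.d (i + 1))}
  have h0 : ∃ t : T 0, ∀ x, Q.d 0 (t.1 x) = h 0 x := by
    obtain ⟨s, hs, hsd⟩ := exists_graded_lift 𝒜 (Q.isInternal 0) (Q.smul_mem 0)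
      (Q.isInternal 1) (Q.smul_mem 1) (Q.d 0) (h 0) (fun x => (Q.exact_aug _).1 (haug x)) (by
        intro j x y hx hxy
        rw [d_homogeneousComponent, hxy, homogeneousComponent_of_mem _ (hdeg _ j _ hx),
          if_pos rfl])
    exact ⟨⟨s, hs, fun x => (Q.exact_d 0 _).1 (by rw [map_sub, hd, hsd, sub_self])⟩, hsd⟩
  have hs : ∀ i (t : T i), ∃ t' : T (i + 1),
      ∀ x, Q.d (i + 1) (t'.1 x) = h (i + 1) x - t.1 (Q.d i x) := by
    intro i t
    obtain ⟨s, hs, hsd⟩ := exists_graded_lift 𝒜 (Q.isInternal (i + 1)) (Q.smul_mem (i + 1))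
      (Q.isInternal (i + 2)) (Q.smul_mem (i + 2)) (Q.d (i + 1)) (h (i + 1) - t.1.comp (Q.d i))
      t.2.2 (by
        intro j x y hx hxy
        rw [d_homogeneousComponent, hxy, LinearMap.sub_apply, LinearMap.comp_apply,
          homogeneousComponent_of_mem _ ((Q.deg _ j).sub_mem (hdeg _ j _ hx)
            (t.2.1 j _ (Q.d_mem _ _ _ hx))), if_pos rfl])
    refine ⟨⟨s, hs, fun x => (Q.exact_d (i + 1) _).1 ?_⟩, hsd⟩
    rw [map_sub, hd, hsd, LinearMap.sub_apply, LinearMap.comp_apply, d_d, map_zero, sub_zero,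
      sub_self]
  choose t0 ht0 using h0
  choose next hnext using hs
  let F : ∀ i, T i := fun i => Nat.rec t0 next i
  exact ⟨fun i => (F i).1, fun i => (F i).2.1, fun x => (ht0 x).symm,
    fun i x => (sub_eq_iff_eq_add.1 (hnext i (F i) x).symm)⟩

theorem map_mem_smul_top {M M' : Type*} [AddCommGroup M] [Module A M] [AddCommGroup M']
    [Module A M'] (I : Ideal A) (f : M →ₗ[A] M') {x : M} (hx : x ∈ I • (⊤ : Submodule A M)) :
    f x ∈ I • (⊤ : Submodule A M') :=
  Submodule.smul_top_le_comap_smul_top I f hx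

/-- The vanishing of graded `Tor` does not depend on the resolution. -/
theorem subsingleton_tor_of_subsingleton_tor (P Q : GradedProjectiveResolution 𝒜) (i : ℕ) (j : ℤ)
    (hP : Subsingleton (P.Tor i j)) : Subsingleton (Q.Tor i j) := by
  rw [subsingleton_tor_iff] at hP ⊢
  intro x hx hc
  obtain ⟨f, hf, hfa, hfd⟩ := exists_chainMap Q P
  obtain ⟨g, hg, hga, hgd⟩ := exists_chainMap P Q
  obtain ⟨s, hs, hs0, hsd⟩ := exists_homotopy Q (fun i => LinearMap.id - (g i).comp (f i))
    (fun i j x hx => (Q.deg i j).sub_mem hx (hg i j _ (hf i j x hx)))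
    (fun x => by simp [hga, hfa]) (fun i x => by simp [hgd, hfd])
  have hfc : (Submodule.Quotient.mk (f i x) : P.Red i) ∈ P.cycles i := by
    cases i with
    | zero => trivial
    | succ i =>
      rw [mk_mem_cycles_succ] at hc ⊢
      rw [hfd]
      exact map_mem_smul_top _ _ hc
  obtain ⟨y, hy, hxy⟩ := hP _ (hf i j x hx) hfc
  refine ⟨s i x + g (i + 1) y, (Q.deg _ j).add_mem (hs i j x hx) (hg _ j y hy), ?_⟩
  have hgy := map_mem_smul_top (augIdeal 𝒜) (g i) hxy
  rw [map_sub, ← hgd] at hgy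
  cases i with
  | zero =>
    have := hs0 x
    simp only [LinearMap.sub_apply, LinearMap.id_apply, LinearMap.comp_apply] at this
    rw [map_add, ← this]
    convert hgy using 1
    abel
  | succ i =>
    have := hsd i x
    simp only [LinearMap.sub_apply, LinearMap.id_apply, LinearMap.comp_apply] at this
    rw [map_add, ← sub_eq_iff_eq_add.2 this]
    rw [mk_mem_cycles_succ] at hc
    convert Submodule.add_mem _ hgy (map_mem_smul_top _ (s i) hc) using 1
    abel

end GradedProjectiveResolution

/-! ### Exactness is an open condition -/

section OpenExact

open Matrix

variable {K : Type*} [Field K]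

/-- Over a field, an exact pair of maps admits a contraction of its middle term. -/
theorem exists_contraction {E F G : Type*} [AddCommGroup E] [Module K E] [AddCommGroup F]
    [Module K F] [AddCommGroup G] [Module K G] (g : G →ₗ[K] E) (f : E →ₗ[K] F)
    (hex : ∀ z, f z = 0 → ∃ y, g y = z) :
    ∃ (S : E →ₗ[K] G) (T : F →ₗ[K] E), ∀ z, g (S z) + T (f z) = z := by
  obtain ⟨T, hT⟩ := f.rangeRestrict.exists_rightInverse_of_surjective f.range_rangeRestrict
  obtain ⟨T', hT'⟩ := T.exists_extend
  obtain ⟨S, hS⟩ := g.rangeRestrict.exists_rightInverse_of_surjective g.range_rangeRestrict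
  obtain ⟨S', hS'⟩ := S.exists_extend
  have hfT : ∀ z, f (T' (f z)) = f z := by
    intro z
    have h1 : T' (f z) = T ⟨f z, z, rfl⟩ := LinearMap.congr_fun hT' ⟨f z, z, rfl⟩
    rw [h1]
    exact congrArg Subtype.val (LinearMap.congr_fun hT ⟨f z, z, rfl⟩)
  refine ⟨S'.comp (LinearMap.id - T'.comp f), T', fun z => ?_⟩
  have hz : z - T' (f z) ∈ LinearMap.range g := hex _ (by rw [map_sub, hfT, sub_self])
  have h1 : S' (z - T' (f z)) = S ⟨_, hz⟩ := LinearMap.congr_fun hS' ⟨_, hz⟩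
  have h2 : g (S ⟨_, hz⟩) = z - T' (f z) := congrArg Subtype.val (LinearMap.congr_fun hS ⟨_, hz⟩)
  simp [h1, h2]

/-- For a family of complexes of matrices with polynomial entries, exactness at a point persists
on a principal Zariski open neighbourhood of the point. The polynomial is the determinant of
`S D₁ + D₀ T`, where `S`, `T` form a contraction at the given point; at any other point where it
does not vanish, this matrix restricts to an automorphism of the space of cycles with image in
the space of boundaries. -/
theorem exists_polynomial_exact {σ l m n : Type*} [Fintype l] [Fintype m] [Fintype n]
    (D₁ : Matrix l m (MvPolynomial σ K)) (D₀ : Matrix m n (MvPolynomial σ K)) (x : σ → K)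
    (hex : ∀ z : m → K, z ᵥ* D₀.map (MvPolynomial.eval x) = 0 →
      ∃ y, y ᵥ* D₁.map (MvPolynomial.eval x) = z) :
    ∃ p : MvPolynomial σ K, MvPolynomial.eval x p ≠ 0 ∧ ∀ x', MvPolynomial.eval x' p ≠ 0 →
      D₁.map (MvPolynomial.eval x') * D₀.map (MvPolynomial.eval x') = 0 →
      ∀ z : m → K, z ᵥ* D₀.map (MvPolynomial.eval x') = 0 →
        ∃ y, y ᵥ* D₁.map (MvPolynomial.eval x') = z := by
  classical
  obtain ⟨S, T, hST⟩ := exists_contraction (D₁.map (MvPolynomial.eval x)).vecMulLinear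
    (D₀.map (MvPolynomial.eval x)).vecMulLinear hex
  obtain ⟨S, rfl⟩ := (LinearMap.toMatrixRight' (R := K)).symm.surjective S
  obtain ⟨T, rfl⟩ := (LinearMap.toMatrixRight' (R := K)).symm.surjective T
  let S' : Matrix m l (MvPolynomial σ K) := S.map MvPolynomial.C
  let T' : Matrix n m (MvPolynomial σ K) := T.map MvPolynomial.C
  let U : Matrix m m (MvPolynomial σ K) := S' * D₁ + D₀ * T'
  have hU : ∀ x', U.map (MvPolynomial.eval x') =
      S * D₁.map (MvPolynomial.eval x') + D₀.map (MvPolynomial.eval x') * T := by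
    intro x'
    simp only [U]
    rw [Matrix.map_add _ (map_add _), Matrix.map_mul, Matrix.map_mul]
    congr 2 <;> (ext; simp [S', T'])
  have hdet : ∀ x', MvPolynomial.eval x' U.det =
      (S * D₁.map (MvPolynomial.eval x') + D₀.map (MvPolynomial.eval x') * T).det := by
    intro x'
    rw [RingHom.map_det, RingHom.mapMatrix_apply, hU]
  refine ⟨U.det, ?_, ?_⟩
  · rw [hdet]
    have h1 : S * D₁.map (MvPolynomial.eval x) + D₀.map (MvPolynomial.eval x) * T = 1 := by
      refine Matrix.ext_iff_vecMul.2 fun z => ?_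
      rw [vecMul_add, vecMul_one, ← vecMul_vecMul, ← vecMul_vecMul]
      exact hST z
    rw [h1, det_one]
    exact one_ne_zero
  · intro x' hx' hzero z hz
    rw [hdet] at hx'
    set M₁ := D₁.map (MvPolynomial.eval x')
    set M₀ := D₀.map (MvPolynomial.eval x')
    have hinj : Function.Injective (S * M₁ + M₀ * T).vecMul :=
      Matrix.vecMul_injective_of_isUnit ((Matrix.isUnit_iff_isUnit_det _).2 hx'.isUnit)
    let L := LinearMap.ker M₀.vecMulLinear
    have hval : ∀ w ∈ L, w ᵥ* (S * M₁ + M₀ * T) = (w ᵥ* S) ᵥ* M₁ := by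
      intro w hw
      have hw' : w ᵥ* M₀ = 0 := hw
      rw [vecMul_add, ← vecMul_vecMul, ← vecMul_vecMul, hw', zero_vecMul, add_zero]
    have hL : ∀ w ∈ L, (S * M₁ + M₀ * T).vecMulLinear w ∈ L := by
      intro w hw
      change (w ᵥ* (S * M₁ + M₀ * T)) ᵥ* M₀ = 0
      rw [hval w hw, vecMul_vecMul, hzero, vecMul_zero]
    have hres : Function.Injective ((S * M₁ + M₀ * T).vecMulLinear.restrict hL) := by
      intro a b hab
      exact Subtype.ext (hinj (congrArg Subtype.val hab))
    obtain ⟨w, hw⟩ := LinearMap.surjective_of_injective hres ⟨z, hz⟩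
    exact ⟨w.1 ᵥ* S, by rw [← hval _ w.2]; exact congrArg Subtype.val hw⟩

end OpenExact

/-! ### Words and the reduced bar differential -/

section Word

open Matrix

/-- Words of length `n` in the alphabet `I`; they index the standard basis of the `n`-th term of
the reduced bar complex. -/
inductive Word (I : Type) : ℕ → Type
  | nil : Word I 0
  | cons {n : ℕ} (a : I) (w : Word I n) : Word I (n + 1)

/-- A nonempty word is a letter followed by a word. -/
def Word.consEquiv (I : Type) (n : ℕ) : I × Word I n ≃ Word I (n + 1) where
  toFun p := .cons p.1 p.2
  invFun | .cons a w => (a, w)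
  left_inv _ := rfl
  right_inv | .cons _ _ => rfl

instance Word.instUnique (I : Type) : Unique (Word I 0) where
  default := .nil
  uniq | .nil => rfl

instance Word.instFintype (I : Type) [Fintype I] : ∀ n, Fintype (Word I n)
  | 0 => inferInstance
  | n + 1 => letI := Word.instFintype I n; Fintype.ofEquiv _ (Word.consEquiv I n)

instance Word.instDecidableEq (I : Type) [DecidableEq I] : ∀ n, DecidableEq (Word I n)
  | 0 => inferInstance
  | n + 1 => letI := Word.instDecidableEq I n; (Word.consEquiv I n).symm.decidableEq

variable {I : Type}

/-- The total degree of a word. -/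
def wordDeg (deg : I → ℤ) : ∀ {n}, Word I n → ℤ
  | _, .nil => 0
  | _, .cons a w => deg a + wordDeg deg w

theorem sum_word_succ [Fintype I] {M : Type*} [AddCommMonoid M] (n : ℕ) (f : Word I (n + 1) → M) :
    ∑ w, f w = ∑ a, ∑ w, f (.cons a w) := by
  rw [← (Word.consEquiv I n).sum_comp, Fintype.sum_prod_type]
  rfl

variable [DecidableEq I] {R : Type*} [CommRing R]

/-- The entries of the differential of the reduced bar complex of an algebra with structure
constants `c`. Letting a letter `a` act on a word `w` through the row `(a, w)`, the recursion
reads `a · (b ⊗ w) = ab ⊗ w - a ⊗ (b · w)`. -/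
def barCoeff (c : I → I → I → R) : ∀ n, Word I (n + 1) → Word I n → R
  | 0, _, _ => 0
  | n + 1, .cons a (.cons b w), .cons k v =>
    c a b k * (if w = v then 1 else 0) - if k = a then barCoeff c n (.cons b w) v else 0

/-- The differential of the reduced bar complex as a matrix acting on row vectors. -/
def barD (c : I → I → I → R) (n : ℕ) : Matrix (Word I (n + 1)) (Word I n) R :=
  Matrix.of (barCoeff c n)

@[simp]
theorem barCoeff_zero (c : I → I → I → R) (p : Word I 1) (v : Word I 0) : barCoeff c 0 p v = 0 := by
  rw [barCoeff]

theorem barCoeff_succ (c : I → I → I → R) (n : ℕ) (a b k : I) (w v : Word I n) :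
    barCoeff c (n + 1) (.cons a (.cons b w)) (.cons k v) =
      c a b k * (if w = v then 1 else 0) - if k = a then barCoeff c n (.cons b w) v else 0 := rfl

theorem barCoeff_map {S : Type*} [CommRing S] (φ : R →+* S) (c : I → I → I → R) :
    ∀ n p q, φ (barCoeff c n p q) = barCoeff (fun a b k => φ (c a b k)) n p q
  | 0, _, _ => by simp
  | n + 1, .cons a (.cons b w), .cons k v => by
    rw [barCoeff_succ, barCoeff_succ, ← barCoeff_map φ c n]
    split_ifs <;> simp

theorem wordDeg_eq_of_barCoeff_ne_zero {deg : I → ℤ} {c : I → I → I → R}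
    (hc : ∀ a b k, c a b k ≠ 0 → deg k = deg a + deg b) :
    ∀ n (p : Word I (n + 1)) (v : Word I n), barCoeff c n p v ≠ 0 →
      wordDeg deg p = wordDeg deg v
  | 0, _, _, h => absurd (barCoeff_zero c _ _) h
  | n + 1, .cons a (.cons b w), .cons k v, h => by
    rw [barCoeff_succ] at h
    have ih := wordDeg_eq_of_barCoeff_ne_zero hc n (.cons b w) v
    simp only [wordDeg] at ih ⊢
    by_cases h1 : k = a ∧ barCoeff c n (.cons b w) v ≠ 0
    · rw [h1.1, ih h1.2]
    · have h2 : (if k = a then barCoeff c n (.cons b w) v else 0) = 0 := by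
        split_ifs with hk
        · by_contra h3
          exact h1 ⟨hk, h3⟩
        · rfl
      rw [h2, sub_zero] at h
      have h3 := hc a b k (left_ne_zero_of_mul h)
      have h4 : w = v := by
        by_contra h5
        simp [h5] at h
      rw [h3, h4]
      ring

variable [Fintype I]

/-- For associative structure constants, words form a module: `(ab) · w = a · (b · w)`. -/
theorem sum_mul_barCoeff {c : I → I → I → R}
    (hc : ∀ a b d l, ∑ k, c a b k * c k d l = ∑ k, c b d k * c a k l) :
    ∀ n (a b : I) (w v : Word I n),
      ∑ k, c a b k * barCoeff c n (.cons k w) v =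
        ∑ u, barCoeff c n (.cons b w) u * barCoeff c n (.cons a u) v
  | 0, a, b, w, v => by simp
  | n + 1, a, b, .cons d w, .cons l v => by
    have ih := sum_mul_barCoeff hc n b d w v
    rw [sum_word_succ]
    simp only [barCoeff_succ, mul_sub, sub_mul, Finset.sum_sub_distrib]
    have e1 : ∑ k, c a b k * (c k d l * if w = v then 1 else 0) =
        ∑ k, ∑ u, c b d k * (if w = u then 1 else 0) * (c a k l * if u = v then 1 else 0) := by
      by_cases h : w = v
      · subst h
        simpa using hc a b d l
      · simp [h]
    have e2 : ∑ k, c a b k * (if l = k then barCoeff c n (.cons d w) v else 0) =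
        ∑ k, ∑ u, (if k = b then barCoeff c n (.cons d w) u else 0) *
          (c a k l * if u = v then 1 else 0) := by
      rw [Finset.sum_comm]
      simp [ite_mul, mul_comm]
    have e3 : ∑ k, ∑ u, c b d k * (if w = u then 1 else 0) *
          (if l = a then barCoeff c n (.cons k u) v else 0) =
        ∑ k, ∑ u, (if k = b then barCoeff c n (.cons d w) u else 0) *
          (if l = a then barCoeff c n (.cons k u) v else 0) := by
      rw [Finset.sum_comm (f := fun k u => (if k = b then barCoeff c n (.cons d w) u else 0) *
          (if l = a then barCoeff c n (.cons k u) v else 0))]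
      split_ifs
      · simpa [ite_mul] using ih
      · simp
    rw [e1, e2, e3]
    ring

theorem barD_mul_barD {c : I → I → I → R}
    (hc : ∀ a b d l, ∑ k, c a b k * c k d l = ∑ k, c b d k * c a k l) (n : ℕ) :
    barD c (n + 1) * barD c n = 0 := by
  ext p v
  obtain _ | ⟨a, _ | ⟨b, w⟩⟩ := p
  rw [Matrix.mul_apply, sum_word_succ]
  simp only [barD, Matrix.of_apply, barCoeff_succ, sub_mul, Finset.sum_sub_distrib,
    Matrix.zero_apply]
  rw [sub_eq_zero]
  have h := sum_mul_barCoeff hc n a b w v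
  rw [Finset.sum_comm (f := fun k u => (if k = a then barCoeff c n (.cons b w) u else 0) *
    barCoeff c n (.cons k u) v)]
  simpa [mul_assoc, ite_mul] using h

/-- Exactness of the reduced bar complex in homological degree `n + 1` and internal degree `j`,
for the alphabet `I` with degrees `deg` and structure constants `c`. -/
def BarExact (deg : I → ℤ) (c : I → I → I → R) (n : ℕ) (j : ℤ) : Prop :=
  ∀ z : Word I (n + 1) → R, (∀ w, z w ≠ 0 → wordDeg deg w = j) → z ᵥ* barD c n = 0 →
    ∃ y : Word I (n + 2) → R, (∀ w, y w ≠ 0 → wordDeg deg w = j) ∧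
      y ᵥ* barD c (n + 1) = z

end Word

/-! ### Homogeneous bases of connected graded algebras -/

/-- A homogeneous basis of a graded algebra consisting of `1` and of vectors `vec a` of positive
degree, given with its coordinate functions: `aug` is the coordinate of `1`. Such a basis exists
if and only if the algebra is finite-dimensional and connected, i.e. `𝒜 0 = K` and `𝒜 i = 0` for
`i < 0`. -/
structure AugBasis {K : Type*} [Field K] {A : Type*} [Ring A] [Algebra K A]
    (𝒜 : ℤ → Submodule K A) (I : Type) [Fintype I] [DecidableEq I] where
  deg : I → ℤ
  vec : I → A
  coord : I → A →ₗ[K] K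
  aug : A →ₗ[K] K
  one_le_deg : ∀ a, 1 ≤ deg a
  vec_mem : ∀ a, vec a ∈ 𝒜 (deg a)
  coord_vec : ∀ a b, coord a (vec b) = if a = b then 1 else 0
  coord_one : ∀ a, coord a 1 = 0
  aug_vec : ∀ a, aug (vec a) = 0
  aug_one : aug 1 = 1
  expand : ∀ x, aug x • (1 : A) + ∑ a, coord a x • vec a = x

namespace AugBasis

open Matrix

variable {K : Type u} [Field K] {A : Type v} [Ring A] [Algebra K A] {𝒜 : ℤ → Submodule K A}
  {I : Type} [Fintype I] [DecidableEq I] (β : AugBasis 𝒜 I)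

/-- The structure constants of the multiplication of `A` on its augmentation ideal. -/
def structConst (a b k : I) : K := β.coord k (β.vec a * β.vec b)

theorem aug_algebraMap (r : K) : β.aug (algebraMap K A r) = r := by
  rw [Algebra.algebraMap_eq_smul_one, map_smul, aug_one, smul_eq_mul, mul_one]

/-- Coordinates of a product with a basis vector on the right. -/
theorem coord_mul_vec (l k : I) (x : A) :
    β.coord l (x * β.vec k) =
      (if l = k then β.aug x else 0) + ∑ a, β.coord a x * β.structConst a k l := by
  conv_lhs => rw [← β.expand x]
  simp [add_mul, Finset.sum_mul, coord_vec, structConst]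

section Graded

variable [GradedAlgebra 𝒜]

theorem aug_eq_zero_of_mem {j : ℤ} {x : A} (hx : x ∈ 𝒜 j) (hj : j ≠ 0) : β.aug x = 0 := by
  have h := congrArg (GradedAlgebra.proj 𝒜 0) (β.expand x)
  have h1 : GradedAlgebra.proj 𝒜 0 (1 : A) = 1 :=
    DirectSum.decompose_of_mem_same 𝒜 (SetLike.GradedOne.one_mem)
  have h2 : ∀ a, GradedAlgebra.proj 𝒜 0 (β.vec a) = 0 := fun a =>
    DirectSum.decompose_of_mem_ne 𝒜 (β.vec_mem a) (by have := β.one_le_deg a; omega)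
  have h3 : GradedAlgebra.proj 𝒜 0 x = 0 := DirectSum.decompose_of_mem_ne 𝒜 hx hj
  simp only [map_add, map_smul, map_sum, h1, h2, h3, smul_zero, Finset.sum_const_zero,
    add_zero] at h
  simpa [aug_one] using congrArg β.aug h

theorem deg_eq_of_coord_ne_zero {j : ℤ} {x : A} (hx : x ∈ 𝒜 j) {a : I} (ha : β.coord a x ≠ 0) :
    β.deg a = j := by
  by_contra hj
  apply ha
  have h := congrArg (GradedAlgebra.proj 𝒜 (β.deg a)) (β.expand x)
  have h1 : GradedAlgebra.proj 𝒜 (β.deg a) (1 : A) = 0 :=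
    DirectSum.decompose_of_mem_ne 𝒜 (SetLike.GradedOne.one_mem)
      (by have := β.one_le_deg a; omega)
  have h3 : GradedAlgebra.proj 𝒜 (β.deg a) x = 0 :=
    DirectSum.decompose_of_mem_ne 𝒜 hx (Ne.symm hj)
  have h2 : ∀ b, GradedAlgebra.proj 𝒜 (β.deg a) (β.vec b) =
      if β.deg b = β.deg a then β.vec b else 0 := by
    intro b
    split_ifs with hb
    · exact DirectSum.decompose_of_mem_same 𝒜 (hb ▸ β.vec_mem b)
    · exact DirectSum.decompose_of_mem_ne 𝒜 (β.vec_mem b) hb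
  simp only [map_add, map_smul, map_sum, h1, h2, h3, smul_zero, zero_add] at h
  have h' := congrArg (β.coord a) h
  rw [map_sum, map_zero, Finset.sum_eq_single a] at h'
  · simpa [β.coord_vec] using h'
  · intro b _ hb
    split_ifs <;> simp [β.coord_vec, Ne.symm hb]
  · simp

theorem deg_eq_of_structConst_ne_zero (a b k : I) (h : β.structConst a b k ≠ 0) :
    β.deg k = β.deg a + β.deg b :=
  β.deg_eq_of_coord_ne_zero (SetLike.GradedMul.mul_mem (β.vec_mem a) (β.vec_mem b)) h

theorem aug_mul_of_mem_augIdeal (y : A) {x : A} (hx : x ∈ augIdeal 𝒜) : β.aug (y * x) = 0 := by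
  induction hx using Submodule.span_induction generalizing y with
  | zero => simp
  | add x x' _ _ hx hx' => rw [mul_add, map_add, hx, hx', add_zero]
  | smul z x _ hx => rw [smul_eq_mul, ← mul_assoc, hx]
  | mem x hx =>
    obtain ⟨i, hi, hx⟩ := hx
    have h : ∀ a, β.aug (β.vec a * x) = 0 := fun a =>
      β.aug_eq_zero_of_mem (SetLike.GradedMul.mul_mem (β.vec_mem a) hx)
        (by have := β.one_le_deg a; omega)
    rw [← β.expand y]
    simp [add_mul, Finset.sum_mul, h, β.aug_eq_zero_of_mem hx (by omega)]

theorem mem_augIdeal_iff (x : A) : x ∈ augIdeal 𝒜 ↔ β.aug x = 0 := by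
  constructor
  · intro hx
    simpa using β.aug_mul_of_mem_augIdeal 1 hx
  · intro hx
    rw [← β.expand x, hx, zero_smul, zero_add]
    exact Submodule.sum_mem _ fun a _ => Submodule.smul_of_tower_mem _ _
      (Ideal.subset_span ⟨_, β.one_le_deg a, β.vec_mem a⟩)

theorem aug_mul (x y : A) : β.aug (x * y) = β.aug x * β.aug y := by
  have h := β.aug_mul_of_mem_augIdeal x (x := y - β.aug y • 1)
    ((β.mem_augIdeal_iff _).2 (by simp [aug_one]))
  rw [mul_sub, map_sub, mul_smul_comm, mul_one, map_smul, sub_eq_zero, smul_eq_mul] at h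
  rw [h, mul_comm]

theorem sum_structConst_smul (a b : I) :
    ∑ k, β.structConst a b k • β.vec k = β.vec a * β.vec b := by
  conv_rhs => rw [← β.expand (β.vec a * β.vec b)]
  simp [aug_mul, aug_vec, structConst]

theorem structConst_assoc (a b d l : I) :
    ∑ k, β.structConst a b k * β.structConst k d l =
      ∑ k, β.structConst b d k * β.structConst a k l := by
  have h1 : β.coord l ((∑ k, β.structConst a b k • β.vec k) * β.vec d) =
      ∑ k, β.structConst a b k * β.structConst k d l := by
    simp [Finset.sum_mul, structConst]
  have h2 : β.coord l (β.vec a * ∑ k, β.structConst b d k • β.vec k) =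
      ∑ k, β.structConst b d k * β.structConst a k l := by
    simp [Finset.mul_sum, structConst]
  rw [← h1, ← h2, sum_structConst_smul, sum_structConst_smul, mul_assoc]

/-- In a free module over a connected algebra, `J • ⊤` consists of the vectors with coordinates
in the augmentation ideal `J`. -/
theorem mem_augIdeal_smul_top_iff {ι : Type*} [Fintype ι] (f : ι → A) :
    f ∈ augIdeal 𝒜 • (⊤ : Submodule A (ι → A)) ↔ ∀ w, β.aug (f w) = 0 := by
  classical
  constructor
  · intro hf w
    induction hf using Submodule.smul_induction_on' with
    | smul r hr g _ => simp [aug_mul, (β.mem_augIdeal_iff r).1 hr]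
    | add f _ g _ hf hg => simp [hf, hg]
  · intro hf
    rw [← Finset.univ_sum_single f]
    refine Submodule.sum_mem _ fun w _ => ?_
    have h : Pi.single w (f w) = f w • (Pi.single w 1 : ι → A) := by
      rw [← Pi.single_smul, smul_eq_mul, mul_one]
    rw [h]
    exact Submodule.smul_mem_smul ((β.mem_augIdeal_iff _).2 (hf w)) trivial

end Graded

/-! ### The bar resolution -/

/-- The differential of the bar resolution, whose `n`-th term is the free `A`-module on the words
of length `n`. -/
def barMap (n : ℕ) : (Word I (n + 1) → A) →ₗ[A] (Word I n → A) where
  toFun f v := ∑ a, f (.cons a v) * β.vec a - ∑ p, barCoeff β.structConst n p v • f p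
  map_add' f g := by
    ext v
    simp only [Pi.add_apply, add_mul, smul_add, Finset.sum_add_distrib]
    abel
  map_smul' r f := by
    ext v
    simp [mul_assoc, Finset.mul_sum, mul_sub]

theorem barMap_apply (n : ℕ) (f : Word I (n + 1) → A) (v : Word I n) :
    β.barMap n f v =
      ∑ a, f (.cons a v) * β.vec a - ∑ p, barCoeff β.structConst n p v • f p := rfl

/-- The contracting homotopy `a ⊗ w ↦ 1 ⊗ ā ⊗ w` of the bar resolution, where `ā` is the
component of `a` in the augmentation ideal. -/
def barHomotopy (n : ℕ) (f : Word I n → A) : Word I (n + 1) → A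
  | .cons a w => algebraMap K A (β.coord a (f w))

theorem barHomotopy_zero (n : ℕ) : β.barHomotopy n 0 = 0 := by
  ext ⟨⟩
  simp [barHomotopy]

theorem sum_barHomotopy_mul_vec (n : ℕ) (f : Word I n → A) (w : Word I n) :
    ∑ a, β.barHomotopy n f (.cons a w) * β.vec a = f w - algebraMap K A (β.aug (f w)) := by
  conv_rhs => rw [← β.expand (f w)]
  simp [barHomotopy, Algebra.algebraMap_eq_smul_one, aug_one, aug_vec]

theorem barMap_zero_barHomotopy (f : Word I 0 → A) (w : Word I 0) :
    β.barMap 0 (β.barHomotopy 0 f) w = f w - algebraMap K A (β.aug (f w)) := by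
  rw [barMap_apply, sum_barHomotopy_mul_vec]
  simp

/-- The contracting identity `d s + s d = 1` in positive homological degrees. -/
theorem barMap_barHomotopy (n : ℕ) (f : Word I (n + 1) → A) :
    β.barMap (n + 1) (β.barHomotopy (n + 1) f) + β.barHomotopy n (β.barMap n f) = f := by
  ext ⟨l, v⟩
  rename_i l v
  have e2 : ∑ p, barCoeff β.structConst (n + 1) p (.cons l v) • β.barHomotopy (n + 1) f p =
      algebraMap K A (∑ b, ∑ a, β.coord a (f (.cons b v)) * β.structConst a b l -
        ∑ q, barCoeff β.structConst n q v * β.coord l (f q)) := by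
    have h : ∀ p, barCoeff β.structConst (n + 1) p (.cons l v) • β.barHomotopy (n + 1) f p =
        algebraMap K A (barCoeff β.structConst (n + 1) p (.cons l v) *
          match p with | .cons a w => β.coord a (f w)) := by
      rintro ⟨⟩
      simp [barHomotopy, Algebra.smul_def]
    rw [Finset.sum_congr rfl fun p _ => h p, ← map_sum, sum_word_succ]
    simp only [sum_word_succ (n := n)]
    simp only [barCoeff_succ, sub_mul, Finset.sum_sub_distrib]
    congr 2
    · rw [Finset.sum_comm]
      simp [mul_comm]
    · simp [ite_mul]
  have e3 : β.barHomotopy n (β.barMap n f) (.cons l v) =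
      algebraMap K A (∑ k, β.coord l (f (.cons k v) * β.vec k) -
        ∑ q, barCoeff β.structConst n q v * β.coord l (f q)) := by
    simp [barHomotopy, barMap_apply]
  rw [Pi.add_apply, barMap_apply, sum_barHomotopy_mul_vec, e2, e3]
  simp only [coord_mul_vec, Finset.sum_add_distrib, map_sub, map_add]
  simp
  abel

variable [GradedAlgebra 𝒜]

theorem barMap_barMap (n : ℕ) (f : Word I (n + 2) → A) : β.barMap n (β.barMap (n + 1) f) = 0 := by
  ext v
  have hD : ∀ p, ∑ q, barCoeff β.structConst n q v * barCoeff β.structConst (n + 1) p q = 0 := by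
    intro p
    have h := congrFun (congrFun (barD_mul_barD β.structConst_assoc n) p) v
    rw [Matrix.mul_apply] at h
    simpa [barD, mul_comm] using h
  -- this product cancels the iterated product `f * vec a * vec k` in `d (d f)` through the first
  -- summand of `barCoeff_succ`, and the cross term of `d (d f)` through the second
  have e1 : ∑ k, (∑ p, barCoeff β.structConst (n + 1) p (.cons k v) • f p) * β.vec k =
      ∑ k, ∑ a, f (.cons a (.cons k v)) * β.vec a * β.vec k -
      ∑ q, ∑ a, barCoeff β.structConst n q v • (f (.cons a q) * β.vec a) := by
    have h : ∀ a b, ∑ k, ∑ w, ((β.structConst a b k * (if w = v then 1 else 0)) •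
        f (.cons a (.cons b w))) * β.vec k = f (.cons a (.cons b v)) * β.vec a * β.vec b := by
      intro a b
      rw [mul_assoc, ← sum_structConst_smul, Finset.mul_sum]
      simp [ite_smul, ite_mul]
    have h' : ∀ a, ∑ k, ∑ q, ((if k = a then barCoeff β.structConst n q v else 0) •
        f (.cons a q)) * β.vec k =
        ∑ q, barCoeff β.structConst n q v • (f (.cons a q) * β.vec a) := by
      intro a
      rw [Finset.sum_comm]
      simp [ite_smul, ite_mul]
    rw [Finset.sum_comm (s := Finset.univ (α := Word I (n + 1))),
      ← Finset.sum_congr rfl fun a _ => h' a,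
      Finset.sum_comm (f := fun k a => f (.cons a (.cons k v)) * β.vec a * β.vec k)]
    simp only [← h]
    rw [← Finset.sum_sub_distrib]
    simp only [sum_word_succ, barCoeff_succ, sub_smul, Finset.sum_mul, sub_mul,
      Finset.sum_sub_distrib]
    refine congrArg₂ (· - ·) ?_ ?_
    · rw [Finset.sum_comm]
      exact Finset.sum_congr rfl fun a _ => Finset.sum_comm
    · exact Finset.sum_comm
  have e2 : ∑ q, barCoeff β.structConst n q v •
      ∑ p, barCoeff β.structConst (n + 1) p q • f p = 0 := by
    simp only [Finset.smul_sum, smul_smul]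
    rw [Finset.sum_comm]
    simp only [← Finset.sum_smul, hD, zero_smul, Finset.sum_const_zero]
  rw [barMap_apply]
  simp only [barMap_apply, sub_mul, smul_sub, Finset.sum_sub_distrib, e1, e2]
  simp [Finset.sum_mul, Finset.smul_sum]

theorem algebraMap_mem {r : K} {j : ℤ} (h : r ≠ 0 → j = 0) : algebraMap K A r ∈ 𝒜 j := by
  by_cases hr : r = 0
  · simp [hr]
  · rw [h hr, Algebra.algebraMap_eq_smul_one]
    exact Submodule.smul_mem _ _ SetLike.GradedOne.one_mem

/-- The grading on the terms of the bar resolution, in which a word has its total degree. -/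
def barDeg (β : AugBasis 𝒜 I) (n : ℕ) (j : ℤ) : AddSubgroup (Word I n → A) where
  carrier := {f | ∀ w, f w ∈ 𝒜 (j - wordDeg β.deg w)}
  add_mem' hf hg w := Submodule.add_mem _ (hf w) (hg w)
  zero_mem' _ := Submodule.zero_mem _
  neg_mem' hf w := Submodule.neg_mem _ (hf w)

theorem barDeg_isInternal (n : ℕ) : DirectSum.IsInternal (β.barDeg n) := by
  refine isInternal_of_projections (fun j => AddMonoidHom.mk' (fun f w =>
    GradedAlgebra.proj 𝒜 (j - wordDeg β.deg w) (f w)) fun f g => by ext w; simp) ?_ ?_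
  · intro i f hf j
    ext w
    simp only [AddMonoidHom.mk'_apply, GradedAlgebra.proj_apply]
    split_ifs with hij
    · subst hij
      exact DirectSum.decompose_of_mem_same 𝒜 (hf w)
    · exact DirectSum.decompose_of_mem_ne 𝒜 (hf w) (by omega)
  · intro f
    rw [← Finset.univ_sum_single f]
    refine AddSubgroup.sum_mem _ fun w _ => ?_
    induction f w using DirectSum.Decomposition.inductionOn 𝒜 with
    | zero => simp
    | add a b ha hb => rw [Pi.single_add]; exact AddSubgroup.add_mem _ ha hb
    | @homogeneous m a =>
      refine AddSubgroup.mem_iSup_of_mem (m + wordDeg β.deg w) fun w' => ?_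
      by_cases hw : w' = w
      · subst hw
        simp
      · simp [hw]

theorem barMap_mem (n : ℕ) (j : ℤ) (f : Word I (n + 1) → A) (hf : f ∈ β.barDeg (n + 1) j) :
    β.barMap n f ∈ β.barDeg n j := by
  intro v
  rw [barMap_apply]
  refine Submodule.sub_mem _ (Submodule.sum_mem _ fun a _ => ?_)
    (Submodule.sum_mem _ fun p _ => ?_)
  · have h := SetLike.GradedMul.mul_mem (hf (.cons a v)) (β.vec_mem a)
    simp only [wordDeg] at h
    convert h using 2
    ring
  · by_cases hp : barCoeff β.structConst n p v = 0
    · simp [hp]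
    · rw [← wordDeg_eq_of_barCoeff_ne_zero β.deg_eq_of_structConst_ne_zero n p v hp]
      exact Submodule.smul_mem _ _ (hf p)

theorem exact_barMap (n : ℕ) : Function.Exact (β.barMap (n + 1)) (β.barMap n) := by
  intro f
  constructor
  · intro hf
    refine ⟨β.barHomotopy (n + 1) f, ?_⟩
    have h := β.barMap_barHomotopy n f
    rwa [hf, barHomotopy_zero, add_zero] at h
  · rintro ⟨g, rfl⟩
    exact β.barMap_barMap n g

/-- The bar resolution of the trivial module over a connected graded algebra. -/
def barResolution : GradedProjectiveResolution 𝒜 where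
  X n := Word I n → A
  deg := β.barDeg
  isInternal := β.barDeg_isInternal
  smul_mem n m j a f ha hf w := by
    have h := SetLike.GradedMul.mul_mem ha (hf w)
    rwa [← add_sub_assoc] at h
  projective n := inferInstance
  d := β.barMap
  d_mem := β.barMap_mem
  aug := (augIdeal 𝒜).mkQ.comp (LinearMap.proj .nil)
  aug_eq_zero j f hj hf := by
    rw [LinearMap.comp_apply, Submodule.mkQ_apply, Submodule.Quotient.mk_eq_zero,
      β.mem_augIdeal_iff]
    exact β.aug_eq_zero_of_mem (hf .nil) (by simpa [wordDeg] using hj)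
  aug_surjective := (Submodule.mkQ_surjective _).comp fun x => ⟨fun _ => x, rfl⟩
  exact_aug f := by
    rw [LinearMap.comp_apply, Submodule.mkQ_apply, Submodule.Quotient.mk_eq_zero,
      β.mem_augIdeal_iff]
    constructor
    · intro hf
      refine ⟨β.barHomotopy 0 f, ?_⟩
      ext w
      rw [barMap_zero_barHomotopy, Subsingleton.elim w .nil]
      simp_all
    · rintro ⟨g, rfl⟩
      simp [barMap_apply, aug_mul, aug_vec]
  exact_d := β.exact_barMap

theorem aug_barMap (n : ℕ) (f : Word I (n + 1) → A) (v : Word I n) :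
    β.aug (β.barMap n f v) = -((fun w => β.aug (f w)) ᵥ* barD β.structConst n) v := by
  simp [barMap_apply, aug_mul, aug_vec, Matrix.vecMul, dotProduct, barD, mul_comm]

/-- The reduction of the bar resolution modulo the augmentation ideal is the reduced bar complex,
up to the signs of the differentials. -/
theorem subsingleton_tor_barResolution_iff (n : ℕ) (j : ℤ) :
    Subsingleton (β.barResolution.Tor (n + 1) j) ↔ BarExact β.deg β.structConst n j := by
  have hsupp : ∀ {m} {f : Word I m → A}, f ∈ β.barDeg m j →
      ∀ w, β.aug (f w) ≠ 0 → wordDeg β.deg w = j := by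
    intro m f hf w hw
    by_contra h
    exact hw (β.aug_eq_zero_of_mem (hf w) (sub_ne_zero.2 (Ne.symm h)))
  have hlift : ∀ {m} {z : Word I m → K}, (∀ w, z w ≠ 0 → wordDeg β.deg w = j) →
      (fun w => algebraMap K A (z w)) ∈ β.barDeg m j := by
    intro m z hz w
    exact algebraMap_mem fun h => sub_eq_zero.2 (hz w h).symm
  rw [GradedProjectiveResolution.subsingleton_tor_iff]
  constructor
  · intro h z hz hzD
    obtain ⟨y, hy, hzy⟩ := h (fun w => algebraMap K A (z w)) (hlift hz) (by
      refine (GradedProjectiveResolution.mk_mem_cycles_succ β.barResolution n _).2 ?_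
      refine (β.mem_augIdeal_smul_top_iff _).2 fun v => ?_
      refine (β.aug_barMap n _ v).trans ?_
      simp [aug_algebraMap, hzD])
    refine ⟨fun w => -β.aug (y w), fun w hw => hsupp hy w (neg_ne_zero.1 hw), ?_⟩
    ext w
    have hw := (β.mem_augIdeal_smul_top_iff _).1 hzy w
    have hb := β.aug_barMap (n + 1) y w
    change β.aug (algebraMap K A (z w) - β.barMap (n + 1) y w) = 0 at hw
    rw [map_sub, aug_algebraMap, hb, sub_neg_eq_add] at hw
    rw [show (fun w => -β.aug (y w)) = -(fun w => β.aug (y w)) from rfl, Matrix.neg_vecMul,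
      Pi.neg_apply]
    exact (eq_neg_of_add_eq_zero_left hw).symm
  · intro h f hf hc
    replace hc := (GradedProjectiveResolution.mk_mem_cycles_succ β.barResolution n _).1 hc
    obtain ⟨y, hy, hyf⟩ := h (fun w => β.aug (f w)) (hsupp hf) (by
      ext v
      have hv := (β.mem_augIdeal_smul_top_iff _).1 hc v
      have hv' := (β.aug_barMap n f v).symm.trans hv
      simpa using hv')
    refine ⟨-fun w => algebraMap K A (y w), (β.barDeg _ j).neg_mem (hlift hy), ?_⟩
    refine (β.mem_augIdeal_smul_top_iff _).2 fun w => ?_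
    have hb := β.aug_barMap (n + 1) (fun w => algebraMap K A (y w)) w
    simp only [aug_algebraMap, hyf] at hb
    change β.aug (f w - β.barMap (n + 1) (-fun w => algebraMap K A (y w)) w) = 0
    rw [map_neg, Pi.neg_apply, sub_neg_eq_add, map_add, hb, add_neg_cancel]

theorem subsingleton_tor_zero_barResolution {j : ℤ} (hj : j ≠ 0) :
    Subsingleton (β.barResolution.Tor 0 j) := by
  rw [GradedProjectiveResolution.subsingleton_tor_iff]
  intro f hf _
  refine ⟨0, AddSubgroup.zero_mem _, ?_⟩
  rw [map_zero, sub_zero]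
  refine (β.mem_augIdeal_smul_top_iff _).2 fun w => β.aug_eq_zero_of_mem (hf w) ?_
  cases w
  simpa [wordDeg] using hj

end AugBasis

/-! ### Openness of exactness of the bar complex -/

section BarExact

open Matrix

variable {K : Type*} [Field K] {I : Type} [Fintype I] [DecidableEq I]

theorem sum_eq_sum_subtype {m M : Type*} [Fintype m] [AddCommMonoid M] (s : m → Prop)
    [DecidablePred s] (f : m → M) (hf : ∀ w, f w ≠ 0 → s w) :
    ∑ w, f w = ∑ w : {w // s w}, f w := by
  rw [← Fintype.sum_subtype_add_sum_subtype s f]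
  have h : ∑ w : {w // ¬ s w}, f w = 0 :=
    Finset.sum_eq_zero fun w _ => by_contra fun h0 => w.2 (hf w h0)
  rw [h, add_zero]

/-- A vector supported on a subset of the index set multiplies a matrix through the rows in that
subset. -/
theorem vecMul_eq_vecMul_submatrix {m n : Type*} [Fintype m] (s : m → Prop) [DecidablePred s]
    (D : Matrix m n K) (z : m → K) (hz : ∀ w, z w ≠ 0 → s w) :
    z ᵥ* D = (fun w : {w // s w} => z w) ᵥ* D.submatrix Subtype.val id := by
  ext v
  exact sum_eq_sum_subtype s (fun w => z w * D w v) fun w hw => hz w (left_ne_zero_of_mul hw)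

/-- In a graded bar complex, exactness in internal degree `j` is a statement about the rows and
columns of degree `j` of the differentials. -/
theorem barExact_iff {deg : I → ℤ} {c : I → I → I → K}
    (hc : ∀ a b k, c a b k ≠ 0 → deg k = deg a + deg b) (n : ℕ) (j : ℤ) :
    BarExact deg c n j ↔ ∀ z : {w : Word I (n + 1) // wordDeg deg w = j} → K,
      z ᵥ* (barD c n).submatrix Subtype.val id = 0 →
      ∃ y : {w : Word I (n + 2) // wordDeg deg w = j} → K,
        y ᵥ* (barD c (n + 1)).submatrix Subtype.val Subtype.val = z := by
  have hext : ∀ {m} (z : {w : Word I m // wordDeg deg w = j} → K),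
      ∃ z' : Word I m → K, (∀ w, z' w ≠ 0 → wordDeg deg w = j) ∧ (fun w => z' w.1) = z := by
    intro m z
    refine ⟨fun w => if h : wordDeg deg w = j then z ⟨w, h⟩ else 0, fun w hw => ?_, ?_⟩
    · by_contra h
      simp [h] at hw
    · ext w
      simp [w.2]
  have hsub : ∀ y : {w : Word I (n + 2) // wordDeg deg w = j} → K,
      ∀ w : {w : Word I (n + 1) // wordDeg deg w = j},
        (y ᵥ* (barD c (n + 1)).submatrix Subtype.val Subtype.val) w =
        (y ᵥ* (barD c (n + 1)).submatrix Subtype.val id) w.1 := fun y w => rfl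
  constructor
  · intro h z hz
    obtain ⟨z', hz', rfl⟩ := hext z
    obtain ⟨y, hy, hyz⟩ := h z' hz' (by rw [vecMul_eq_vecMul_submatrix _ _ _ hz', hz])
    refine ⟨fun w => y w.1, ?_⟩
    ext w
    rw [hsub, ← vecMul_eq_vecMul_submatrix _ _ _ hy, hyz]
  · intro h z hz hzD
    rw [vecMul_eq_vecMul_submatrix _ _ _ hz] at hzD
    obtain ⟨y, hy⟩ := h _ hzD
    obtain ⟨y', hy', rfl⟩ := hext y
    refine ⟨y', hy', ?_⟩
    ext w
    by_cases hw : wordDeg deg w = j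
    · rw [vecMul_eq_vecMul_submatrix _ _ _ hy']
      exact congrFun hy ⟨w, hw⟩
    · have hzw : z w = 0 := by
        by_contra h0
        exact hw (hz w h0)
      rw [hzw]
      refine Finset.sum_eq_zero fun p _ => ?_
      by_contra h0
      exact hw ((wordDeg_eq_of_barCoeff_ne_zero hc _ p w (right_ne_zero_of_mul h0)).symm.trans
        (hy' p (left_ne_zero_of_mul h0)))

/-- Exactness of the bar complex in a fixed bidegree is an open condition on graded associative
structure constants `c`, here given as the values at points `x'` of polynomials `C`. Gradedness
and associativity are only required at the points where exactness is asserted. -/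
theorem exists_polynomial_barExact {σ : Type*} (deg : I → ℤ)
    (C : I → I → I → MvPolynomial σ K) (x : σ → K) (n : ℕ) (j : ℤ)
    (hdeg : ∀ a b k, MvPolynomial.eval x (C a b k) ≠ 0 → deg k = deg a + deg b)
    (hx : BarExact deg (fun a b k => MvPolynomial.eval x (C a b k)) n j) :
    ∃ p : MvPolynomial σ K, MvPolynomial.eval x p ≠ 0 ∧ ∀ x', MvPolynomial.eval x' p ≠ 0 →
      ∀ c : I → I → I → K, (∀ a b k, c a b k = MvPolynomial.eval x' (C a b k)) →
      (∀ a b k, c a b k ≠ 0 → deg k = deg a + deg b) →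
      (∀ a b d l, ∑ k, c a b k * c k d l = ∑ k, c b d k * c a k l) → BarExact deg c n j := by
  have hmap : ∀ x' m, (barD C m).map (MvPolynomial.eval x') =
      barD (fun a b k => MvPolynomial.eval x' (C a b k)) m := by
    intro x' m
    ext p q
    exact barCoeff_map (MvPolynomial.eval x') C m p q
  obtain ⟨p, hp, h⟩ := exists_polynomial_exact
    ((barD C (n + 1)).submatrix (Subtype.val : {w // wordDeg deg w = j} → _)
      (Subtype.val : {w // wordDeg deg w = j} → _))
    ((barD C n).submatrix (Subtype.val : {w // wordDeg deg w = j} → _) id) x (by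
      simp only [← submatrix_map, hmap]
      exact (barExact_iff hdeg n j).1 hx)
  refine ⟨p, hp, fun x' hx' c hc hcdeg hassoc => ?_⟩
  obtain rfl : c = fun a b k => MvPolynomial.eval x' (C a b k) := by
    ext a b k
    exact hc a b k
  rw [barExact_iff hcdeg]
  have h' := h x' hx'
  simp only [← submatrix_map, hmap] at h'
  refine h' ?_
  ext p v
  have h0 := congrFun (congrFun (barD_mul_barD hassoc n) p.1) v
  rw [Matrix.mul_apply, sum_eq_sum_subtype (fun u => wordDeg deg u = j)] at h0
  · exact h0
  · intro u hu
    exact (wordDeg_eq_of_barCoeff_ne_zero hcdeg _ _ u (left_ne_zero_of_mul hu)).symm.trans p.2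

end BarExact

/-! ### Existence and transport of homogeneous bases -/

namespace AugBasis

variable {K : Type*} [Field K]

/-- A graded algebra generated in degree one is connected, hence has a homogeneous basis
containing `1` and otherwise of positive degrees. -/
theorem exists_of_adjoin_eq_top {B : Type*} [Ring B] [Algebra K B] [FiniteDimensional K B]
    [Nontrivial B] (ℬ : ℤ → Submodule K B) [GradedAlgebra ℬ]
    (hgen : Algebra.adjoin K (ℬ 1 : Set B) = ⊤) :
    ∃ (I : Type) (_ : Fintype I) (_ : DecidableEq I), Nonempty (AugBasis ℬ I) := by
  classical
  have hone : (1 : B) ∈ ℬ 0 := SetLike.GradedOne.one_mem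
  have hmon : ∀ y ∈ Submonoid.closure (ℬ 1 : Set B), y = 1 ∨ ∃ n : ℤ, 1 ≤ n ∧ y ∈ ℬ n := by
    intro y hy
    induction hy using Submonoid.closure_induction with
    | mem x hx => exact Or.inr ⟨1, le_rfl, hx⟩
    | one => exact Or.inl rfl
    | mul x y _ _ hx hy =>
      rcases hx with rfl | ⟨m, hm, hx⟩
      · rwa [one_mul]
      · rcases hy with rfl | ⟨n, hn, hy⟩
        · rw [mul_one]
          exact Or.inr ⟨m, hm, hx⟩
        · exact Or.inr ⟨m + n, by omega, SetLike.GradedMul.mul_mem hx hy⟩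
  have hspan : ∀ x : B, x ∈ Submodule.span K (Submonoid.closure (ℬ 1 : Set B) : Set B) := by
    intro x
    rw [← Algebra.adjoin_eq_span, hgen]
    trivial
  have hzero : ∀ x, GradedAlgebra.proj ℬ 0 x ∈ Submodule.span K {(1 : B)} := by
    intro x
    induction hspan x using Submodule.span_induction with
    | zero => simp
    | add x y _ _ hx hy => rw [map_add]; exact Submodule.add_mem _ hx hy
    | smul r x _ hx => rw [map_smul]; exact Submodule.smul_mem _ _ hx
    | mem x hx =>
      rw [GradedAlgebra.proj_apply]
      rcases hmon x hx with rfl | ⟨n, hn, hx⟩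
      · rw [DirectSum.decompose_of_mem_same ℬ hone]
        exact Submodule.mem_span_singleton_self _
      · rw [DirectSum.decompose_of_mem_ne ℬ hx (by omega)]
        exact Submodule.zero_mem _
  have hneg : ∀ i < 0, ∀ x, GradedAlgebra.proj ℬ i x = 0 := by
    intro i hi x
    induction hspan x using Submodule.span_induction with
    | zero => simp
    | add x y _ _ hx hy => rw [map_add, hx, hy, add_zero]
    | smul r x _ hx => rw [map_smul, hx, smul_zero]
    | mem x hx =>
      rw [GradedAlgebra.proj_apply]
      rcases hmon x hx with rfl | ⟨n, hn, hx⟩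
      · exact DirectSum.decompose_of_mem_ne ℬ hone (by omega)
      · exact DirectSum.decompose_of_mem_ne ℬ hx (by omega)
  let ε : B →ₗ[K] K := (LinearEquiv.toSpanNonzeroSingleton K B 1 one_ne_zero).symm.toLinearMap.comp
    ((GradedAlgebra.proj ℬ 0).codRestrict _ hzero)
  have hε : ∀ x, ε x • (1 : B) = GradedAlgebra.proj ℬ 0 x := fun x =>
    congrArg Subtype.val ((LinearEquiv.toSpanNonzeroSingleton K B 1 one_ne_zero).apply_symm_apply
      ⟨GradedAlgebra.proj ℬ 0 x, hzero x⟩)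
  have hε' : ∀ x r, GradedAlgebra.proj ℬ 0 x = r • (1 : B) → ε x = r := fun x r h =>
    smul_left_injective K (one_ne_zero (α := B)) ((hε x).trans h)
  have hint := DirectSum.Decomposition.isInternal ℬ
  let cb := hint.collectedBasis fun i => Module.finBasis K (ℬ i)
  have hcb : ∀ p, cb p ∈ ℬ p.1 := hint.collectedBasis_mem _
  let := FiniteDimensional.fintypeBasisIndex cb
  refine ⟨{p : Σ i, Fin (Module.finrank K (ℬ i)) // 1 ≤ p.1}, inferInstance, inferInstance,
    ⟨{ deg := fun a => a.1.1, vec := fun a => cb a.1, coord := fun a => cb.coord a.1, aug := ε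
       one_le_deg := fun a => a.2
       vec_mem := fun a => hcb a.1
       coord_vec := fun a b => ?_
       coord_one := fun a => ?_
       aug_vec := fun a => hε' _ _ ?_
       aug_one := hε' _ _ ?_
       expand := fun x => ?_ }⟩⟩
  · rw [Module.Basis.coord_apply, Module.Basis.repr_self, Finsupp.single_apply]
    simp [Subtype.ext_iff, eq_comm]
  · obtain ⟨⟨i, m⟩, hi⟩ := a
    have hi0 : 0 ≠ i := (zero_lt_one.trans_le hi).ne
    rw [Module.Basis.coord_apply]
    exact hint.collectedBasis_repr_of_mem_ne _ hi0 hone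
  · rw [zero_smul]
    exact DirectSum.decompose_of_mem_ne ℬ (hcb a.1) (by have := a.2; omega)
  · rw [one_smul]
    exact DirectSum.decompose_of_mem_same ℬ hone
  · rw [hε]
    have hφ : GradedAlgebra.proj ℬ 0 +
        ∑ a : {p : Σ i, Fin (Module.finrank K (ℬ i)) // 1 ≤ p.1},
          (cb.coord a.1).smulRight (cb a.1) = LinearMap.id := by
      refine cb.ext fun p => ?_
      rw [LinearMap.add_apply, LinearMap.sum_apply, LinearMap.id_apply]
      simp only [LinearMap.smulRight_apply, Module.Basis.coord_apply, Module.Basis.repr_self,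
        Finsupp.single_apply, GradedAlgebra.proj_apply]
      rcases lt_trichotomy p.1 0 with hp | hp | hp
      · have h := hneg _ hp (cb p)
        rw [GradedAlgebra.proj_apply, DirectSum.decompose_of_mem_same ℬ (hcb p)] at h
        exact absurd h (cb.ne_zero p)
      · rw [DirectSum.decompose_of_mem_same ℬ (hp ▸ hcb p), Finset.sum_eq_zero, add_zero]
        intro a _
        rw [if_neg, zero_smul]
        rintro rfl
        have := a.2
        omega
      · rw [DirectSum.decompose_of_mem_ne ℬ (hcb p) (by omega), zero_add,
          Finset.sum_eq_single ⟨p, hp⟩]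
        · simp
        · intro a _ ha
          rw [if_neg, zero_smul]
          rintro rfl
          exact ha rfl
        · simp
    simpa using LinearMap.congr_fun hφ x

variable {A : Type*} [Ring A] [Algebra K A] {𝒜 : ℤ → Submodule K A}
  {B : Type*} [Ring B] [Algebra K B] {ℬ : ℤ → Submodule K B}
  {I : Type} [Fintype I] [DecidableEq I]

/-- Transport of a homogeneous basis along a graded linear isomorphism, which need not respect
the multiplications. It sends `1` to a multiple of `1` because the algebra is connected, so only
the coordinate of `1` has to be rescaled. -/
def comapEquiv [GradedAlgebra 𝒜] [GradedAlgebra ℬ] [Nontrivial A] (β : AugBasis ℬ I)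
    (h : A ≃ₗ[K] B) (hdeg : ∀ i, (𝒜 i).map (h : A →ₗ[K] B) = ℬ i) : AugBasis 𝒜 I :=
  have hone : (1 : A) ∈ 𝒜 0 := SetLike.GradedOne.one_mem
  have hmem : h 1 ∈ ℬ 0 := hdeg 0 ▸ Submodule.mem_map_of_mem hone
  have hcoord : ∀ a, β.coord a (h 1) = 0 := fun a => by
    by_contra ha
    have := β.deg_eq_of_coord_ne_zero hmem ha
    have := β.one_le_deg a
    omega
  have hexp : β.aug (h 1) • (1 : B) = h 1 := by
    conv_rhs => rw [← β.expand (h 1)]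
    simp [hcoord]
  have hne : β.aug (h 1) ≠ 0 := fun h0 => by
    rw [h0, zero_smul] at hexp
    exact one_ne_zero (h.map_eq_zero_iff.1 hexp.symm)
  { deg := β.deg
    vec := fun a => h.symm (β.vec a)
    coord := fun a => (β.coord a).comp (h : A →ₗ[K] B)
    aug := (β.aug (h 1))⁻¹ • β.aug.comp (h : A →ₗ[K] B)
    one_le_deg := β.one_le_deg
    vec_mem := fun a => by
      have hv := β.vec_mem a
      rw [← hdeg] at hv
      obtain ⟨x, hx, hxa⟩ := hv
      rw [← hxa]
      simpa using hx
    coord_vec := fun a b => by simp [β.coord_vec]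
    coord_one := hcoord
    aug_vec := fun a => by simp [β.aug_vec]
    aug_one := by simp [hne]
    expand := fun x => by
      apply h.injective
      conv_rhs => rw [← β.expand (h x)]
      rw [map_add, map_smul, ← hexp]
      simp [smul_smul, hne, β.aug_one, mul_comm] }

/-- Exactness of the bar complex in homological degree one and all internal degrees `j ≠ 1` says
that every element of degree `j ≠ 1` of the augmentation ideal is decomposable, so that the
algebra is generated in degree one. The basis may depend on the internal degree. -/
theorem adjoin_eq_top [GradedAlgebra 𝒜]
    (hex : ∀ j : ℕ, j ≠ 1 → ∃ β : AugBasis 𝒜 I, BarExact β.deg β.structConst 0 j) :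
    Algebra.adjoin K (𝒜 1 : Set A) = ⊤ := by
  have hmem : ∀ (n : ℕ) (x : A), x ∈ 𝒜 n → x ∈ Algebra.adjoin K (𝒜 1 : Set A) := by
    intro n
    induction n using Nat.strong_induction_on with
    | _ n ih =>
    intro x hx
    by_cases hn : n = 1
    · subst hn
      exact Algebra.subset_adjoin hx
    obtain ⟨β, hβ⟩ := hex n hn
    obtain ⟨y, hy, hyz⟩ := hβ (fun | .cons a _ => β.coord a x) (by
      intro w ha
      obtain _ | ⟨a, w⟩ := w
      obtain rfl := Subsingleton.elim w .nil
      simpa [wordDeg] using β.deg_eq_of_coord_ne_zero hx ha) (by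
      ext v
      simp [Matrix.vecMul, dotProduct, barD])
    have hcoord : ∀ k, β.coord k x =
        ∑ a, ∑ b, y (.cons a (.cons b .nil)) * β.structConst a b k := by
      intro k
      have h := congrFun hyz (.cons k .nil)
      simp only [Matrix.vecMul, dotProduct, barD, Matrix.of_apply] at h
      rw [← h]
      have hd : (default : Word I 0) = .nil := rfl
      simp [sum_word_succ, barCoeff_succ, hd]
    have hvec : ∀ a, β.deg a < n → β.vec a ∈ Algebra.adjoin K (𝒜 1 : Set A) := by
      intro a ha
      have h1 := β.one_le_deg a
      obtain ⟨m, hm⟩ := Int.eq_ofNat_of_zero_le (zero_le_one.trans h1)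
      exact ih m (by omega) _ (hm ▸ β.vec_mem a)
    rw [← β.expand x]
    refine add_mem (Subalgebra.smul_mem _ (one_mem _) _) ?_
    -- the exactness exhibits the part of `x` in the augmentation ideal as a sum of products of
    -- basis vectors of smaller degrees
    have hsum : ∑ k, β.coord k x • β.vec k =
        ∑ a, ∑ b, y (.cons a (.cons b .nil)) • (β.vec a * β.vec b) := by
      simp only [hcoord, ← sum_structConst_smul, Finset.sum_smul, Finset.smul_sum, smul_smul]
      rw [Finset.sum_comm]
      exact Finset.sum_congr rfl fun a _ => Finset.sum_comm
    rw [hsum]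
    refine sum_mem fun a _ => sum_mem fun b _ => ?_
    by_cases h0 : y (.cons a (.cons b .nil)) = 0
    · rw [h0, zero_smul]
      exact zero_mem _
    · have h1 := hy _ h0
      simp only [wordDeg] at h1
      have ha := β.one_le_deg a
      have hb := β.one_le_deg b
      exact Subalgebra.smul_mem _ (mul_mem (hvec a (by omega)) (hvec b (by omega))) _
  obtain ⟨β, -⟩ := hex 0 zero_ne_one
  refine Algebra.eq_top_iff.2 fun x => ?_
  rw [← β.expand x]
  refine add_mem (Subalgebra.smul_mem _ (one_mem _) _)
    (sum_mem fun a _ => Subalgebra.smul_mem _ ?_ _)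
  obtain ⟨m, hm⟩ := Int.eq_ofNat_of_zero_le (zero_le_one.trans (β.one_le_deg a))
  exact hmem m _ (hm ▸ β.vec_mem a)

/-- Exactness of the bar complex in a given bidegree passes from a graded degeneration `B` to
`A`. -/
theorem exists_barExact_of_isGradedDegeneration [GradedAlgebra 𝒜] [GradedAlgebra ℬ]
    [Nontrivial A] (hdeg : IsGradedDegeneration 𝒜 ℬ) (β : AugBasis ℬ I) (n : ℕ) (j : ℤ)
    (hβ : BarExact β.deg β.structConst n j) :
    ∃ γ : AugBasis 𝒜 I, BarExact γ.deg γ.structConst n j := by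
  obtain ⟨e, he, hsub⟩ := hdeg
  have hmul : LinearMap.mul K B ∈ gradedOrbit ℬ (LinearMap.mul K B) :=
    ⟨LinearEquiv.refl K B, fun i => Submodule.map_id _, rfl⟩
  have hcl := (hsub hmul).2
  let ℓ : I → I → I → Module.Dual K (B →ₗ[K] B →ₗ[K] B) := fun a b k =>
    (β.coord k).comp ((LinearMap.applyₗ (β.vec b)).comp (LinearMap.applyₗ (β.vec a)))
  have hℓ : (fun a b k => MvPolynomial.eval (fun l => l (LinearMap.mul K B))
      (MvPolynomial.X (R := K) (ℓ a b k))) = β.structConst := by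
    ext a b k
    rw [MvPolynomial.eval_X]
    rfl
  obtain ⟨p, hp, hopen⟩ := exists_polynomial_barExact β.deg
    (fun a b k => MvPolynomial.X (ℓ a b k)) (fun l => l (LinearMap.mul K B)) n j
    (fun a b k h => β.deg_eq_of_structConst_ne_zero a b k (by
      rwa [← hℓ]))
    (by rwa [hℓ])
  -- `p` does not vanish at `B`, which lies in the closure of the orbit, so not on the whole orbit
  obtain ⟨_, ⟨g, hg, rfl⟩, hy⟩ : ∃ y ∈ gradedOrbit ℬ (transportMul e (LinearMap.mul K A)),
      MvPolynomial.eval (fun l : Module.Dual K (B →ₗ[K] B →ₗ[K] B) => l y) p ≠ 0 := by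
    by_contra! h
    exact hp (hcl p h)
  have hge : ∀ i, (𝒜 i).map ((e.trans g : A ≃ₗ[K] B) : A →ₗ[K] B) = ℬ i := fun i => by
    rw [LinearEquiv.coe_trans, Submodule.map_comp, he, hg]
  let γ := β.comapEquiv (e.trans g) hge
  refine ⟨γ, hopen _ hy γ.structConst (fun a b k => ?_) γ.deg_eq_of_structConst_ne_zero
    γ.structConst_assoc⟩
  rw [MvPolynomial.eval_X]
  rfl

end AugBasis

theorem proposition4p5 {K : Type*} [Field K] [IsAlgClosed K]
    {A : Type*} [Ring A] [Algebra K A] [FiniteDimensional K A]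
    (𝒜 : ℤ → Submodule K A) [GradedAlgebra 𝒜]
    {B : Type*} [Ring B] [Algebra K B] [FiniteDimensional K B]
    (ℬ : ℤ → Submodule K B) [GradedAlgebra ℬ]
    (hdeg : IsGradedDegeneration 𝒜 ℬ)
    (N : ℕ) (hN : 2 ≤ N) (hB : IsNKoszul N ℬ) :
    IsNKoszul N 𝒜 := by
  have := hB.nontrivial
  have hA : Nontrivial A := by
    obtain ⟨e, -, -⟩ := hdeg
    exact e.toEquiv.nontrivial
  obtain ⟨I, _, _, ⟨β⟩⟩ := AugBasis.exists_of_adjoin_eq_top ℬ hB.generated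
  have hex : ∀ n j : ℕ, j ≠ koszulDegree N (n + 1) →
      ∃ γ : AugBasis 𝒜 I, BarExact γ.deg γ.structConst n j := by
    intro n j hj
    obtain ⟨P, hP⟩ := hB.tor (n + 1) j hj
    exact AugBasis.exists_barExact_of_isGradedDegeneration hdeg β n j
      ((β.subsingleton_tor_barResolution_iff n j).1
        (P.subsingleton_tor_of_subsingleton_tor β.barResolution (n + 1) j hP))
  refine ⟨hA, AugBasis.adjoin_eq_top fun j hj => hex 0 j (by simpa [koszulDegree] using hj),
    fun i j hj => ?_⟩
  cases i with
  | zero =>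
    -- the basis may come from any bidegree, here `(1, 0)`; `Tor` in homological degree zero
    -- vanishes in nonzero internal degrees for every connected algebra
    obtain ⟨γ, -⟩ := hex 0 0 (by simp [koszulDegree])
    exact ⟨γ.barResolution, γ.subsingleton_tor_zero_barResolution
      (by simpa [koszulDegree] using hj)⟩
  | succ n =>
    obtain ⟨γ, hγ⟩ := hex n j hj
    exact ⟨γ.barResolution, (γ.subsingleton_tor_barResolution_iff n j).2 hγ⟩
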